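/- All graphs are finite and simple, and all representations lie between two parallel lines $L_1$ (above) and $L_2$ (below), with all endpoints on each line pairwise distinct. A \emph{permutation} (resp. \emph{trapezoid}) \emph{graph} is the intersection graph of line segments (resp. trapezoids) between $L_1$ and $L_2$; such a family is a permutation (resp. trapezoid) representation of the graph. \emph{Acyclicity.} Let $P$ be a permutation graph whose $2n$ vertices are partitioned into pairs $\{u_i^1,u_i^2\}$, $1\le i\le n$. A permutation representation $R$ of $P$ orients each edge $xy$ of $P$ from the segment with the smaller angle with $L_2$ to the one with the larger angle. Let $F_R$ be the simple directed graph obtained from this orientation by merging $u_i^1$ and $u_i^2$ into one vertex for every $i$. $P$ is \emph{acyclic with respect to} $\{u_i^1,u_i^2\}_{i=1}^n$ if it has a representation $R$ for which $F_R$ has no directed cycle. A trapezoid graph is \emph{acyclic} if it has a trapezoid representation whose left and right lines, viewed as a permutation representation and paired by trapezoid, have this property. \emph{Components.} For a set $S$ of vertices of a graph $G$ let $N(S)=\bigcup_{v\in S}N(v)\setminus S$. For a vertex $u$ and a connected component $C$ of $G\setminus N[u]$ let $D_u(C)$ be the set of components $C'$ of $G\setminus N[u]$ with $N(C')\subseteq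 N(C)$, and let $D_u^*(C)$ be the set of the other components. Let $\delta_u$ be an arbitrarily chosen component $C$ with $|D_u(C)|$ maximum. If $D_u^*(\delta_u)=\emptyset$, let $\delta_u^*=\emptyset$; otherwise let $\delta_u^*$ be an arbitrarily chosen component $C'\in D_u^*(\delta_u)$ such that $N(C')\subsetneq N(C'')$ for no $C''\in D_u^*(\delta_u)$. \emph{Splitting.} Let $N_1(u)$, $N_2(u)$, $N_{12}(u)$ be the sets of neighbors of $u$ that are adjacent to (some vertex of) $\delta_u$ but not $\delta_u^*$, to $\delta_u^*$ but not $\delta_u$, and to both, respectively. The graph $G^{\#}(u)$ arises from $G$ by deleting $u$ and adding two non-adjacent new vertices $u^1,u^2$, the \emph{derivatives} of $u$, where $u^1$ is adjacent to $N_1(u)\cup N_{12}(u)$ and $u^2$ to $N_2(u)\cup N_{12}(u)$. The same rule is used if $\delta_u^*=\emptyset$. \emph{Algorithm Split-$U$.} Given $G$ and $U=\{u_1,\dots,u_k\}\subseteq V(G)$ (with $k$ distinct vertices, in any order), put $H_0=G$ and $H_i=H_{i-1}^{\#}(u_i)$ for $i=1,\dots,k$, where $\delta_{u_i}$ and $\delta_{u_i}^*$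 are chosen in $H_{i-1}$, and return $G^{\#}(U)=H_k[V(H_k)\setminus(V(G)\setminus U)]$. \textbf{Theorem.} Let $G$ be a trapezoid graph and $U=\{u_1,\dots,u_k\}$ a set of $k$ vertices of $G$ such that, in $G$, $\delta_{u_i}^*\neq\emptyset$ for every $i=1,\dots,k$. Then every step of Algorithm Split-$U$ can be carried out ($H_{i-1}\setminus N[u_i]$ always has a component), and, for all choices made during the algorithm, the returned graph $G^{\#}(U)$ is a permutation graph with $2k$ vertices. Furthermore, if $G$ is an acyclic trapezoid graph, then $G^{\#}(U)$ is acyclic with respect to $\{u_i^1,u_i^2\}_{i=1}^k$, where $u_i^1,u_i^2$ are the derivatives of $u_i$. -/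

import Mathlib

universe u

/-! ### Permutation and trapezoid representations

The two parallel lines are `L₁ = {y = 1}` and `L₂ = {y = 0}` in the plane `ℝ × ℝ`.
All endpoints on each of the two lines are pairwise distinct. -/

/-- A family of line segments between `L₁` and `L₂`; the segment of `w` joins the point
`(top w, 1)` of `L₁` to the point `(bot w, 0)` of `L₂`. -/
structure PermRep (W : Type u) where
  top : W → ℝ
  bot : W → ℝ
  top_injective : Function.Injective top
  bot_injective : Function.Injective bot

/-- The segment of `w`, as a set of points of the plane. -/
def PermRep.line {W : Type u} (R : PermRep W) (w : W) : Set (ℝ × ℝ) :=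
  {p | 0 ≤ p.2 ∧ p.2 ≤ 1 ∧ p.1 = (1 - p.2) * R.bot w + p.2 * R.top w}

/-- The intersection graph of the segments. -/
def PermRep.graph {W : Type u} (R : PermRep W) : SimpleGraph W where
  Adj x y := x ≠ y ∧ (R.line x ∩ R.line y).Nonempty
  symm := ⟨fun _ _ h => ⟨h.1.symm, by rw [Set.inter_comm]; exact h.2⟩⟩
  loopless := ⟨fun _ h => h.1 rfl⟩

/-- The angle in `(0, π)` of the segment of `w` with the line `L₂`: the argument of its upward
direction vector `(top w - bot w, 1)`. -/
noncomputable def PermRep.angle {W : Type u} (R : PermRep W) (w : W) : ℝ :=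
  Complex.arg (Complex.mk (R.top w - R.bot w) 1)

/-- The transitive orientation `Φ_R`: the arc from `x` to `y`. -/
def PermRep.orient {W : Type u} (R : PermRep W) (x y : W) : Prop :=
  R.graph.Adj x y ∧ R.angle x < R.angle y

/-- The arcs of the simple directed graph `F_R` obtained from `Φ_R` by merging all vertices
with the same value of `f` into a single vertex. -/
def PermRep.mergedArc {W : Type u} {I : Type u} (R : PermRep W) (f : W → I) (i j : I) : Prop :=
  i ≠ j ∧ ∃ x y : W, f x = i ∧ f y = j ∧ R.orient x y

/-- `R` is acyclic with respect to the classes of `f`: `F_R` has no directed cycle. -/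
def PermRep.IsAcyclic {W : Type u} {I : Type u} (R : PermRep W) (f : W → I) : Prop :=
  ∀ i : I, ¬ Relation.TransGen (R.mergedArc f) i i

def IsPermutationGraph {W : Type u} (P : SimpleGraph W) : Prop :=
  ∃ R : PermRep W, R.graph = P

/-- `P` is an acyclic permutation graph with respect to the pairs `f ⁻¹' {i}`, `i : I`. -/
def IsAcyclicPermutationGraph {W : Type u} {I : Type u} (P : SimpleGraph W) (f : W → I) : Prop :=
  (∀ i : I, (f ⁻¹' {i}).ncard = 2) ∧ ∃ R : PermRep W, R.graph = P ∧ R.IsAcyclic f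

/-- A family of trapezoids between `L₁` and `L₂`, given by their left lines (index `false`)
and right lines (index `true`). -/
structure TrapezoidRep (V : Type u) where
  /-- the permutation representation `R_P` formed by the left and right lines -/
  lines : PermRep (V × Bool)
  top_lt : ∀ v, lines.top (v, false) < lines.top (v, true)
  bot_lt : ∀ v, lines.bot (v, false) < lines.bot (v, true)

/-- The trapezoid of `v`, as a set of points of the plane. -/
def TrapezoidRep.trapezoid {V : Type u} (R : TrapezoidRep V) (v : V) : Set (ℝ × ℝ) :=
  {p | 0 ≤ p.2 ∧ p.2 ≤ 1 ∧
    (1 - p.2) * R.lines.bot (v, false) + p.2 * R.lines.top (v, false) ≤ p.1 ∧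
    p.1 ≤ (1 - p.2) * R.lines.bot (v, true) + p.2 * R.lines.top (v, true)}

/-- The intersection graph of the trapezoids. -/
def TrapezoidRep.graph {V : Type u} (R : TrapezoidRep V) : SimpleGraph V where
  Adj x y := x ≠ y ∧ (R.trapezoid x ∩ R.trapezoid y).Nonempty
  symm := ⟨fun _ _ h => ⟨h.1.symm, by rw [Set.inter_comm]; exact h.2⟩⟩
  loopless := ⟨fun _ h => h.1 rfl⟩

def IsTrapezoidGraph {V : Type u} (G : SimpleGraph V) : Prop :=
  ∃ R : TrapezoidRep V, R.graph = G

/-- `G` has a trapezoid representation `R` such that `R_P` is acyclic with respect to the pairs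
consisting of the left and the right line of each trapezoid. -/
def IsAcyclicTrapezoidGraph {V : Type u} (G : SimpleGraph V) : Prop :=
  ∃ R : TrapezoidRep V, R.graph = G ∧ R.lines.IsAcyclic Prod.fst

/-! ### Neighborhood domination -/

namespace SplitU

variable {V : Type u}

/-- `N(S)`, the vertices outside `S` with a neighbor in `S`. -/
def nbhd (G : SimpleGraph V) (S : Set V) : Set V :=
  (⋃ v ∈ S, G.neighborSet v) \ S

/-- The vertex sets of the connected components of `G \ N[u]`. -/
def components (G : SimpleGraph V) (u : V) : Set (Set V) :=
  Set.range fun c : (G.induce (insert u (G.neighborSet u))ᶜ).ConnectedComponent =>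
    Subtype.val '' c.supp

/-- The neighborhood domination closure `D_u(C)`. -/
def domClosure (G : SimpleGraph V) (u : V) (C : Set V) : Set (Set V) :=
  {D ∈ components G u | nbhd G D ⊆ nbhd G C}

/-- The closure complement `D_u^*(C)`. -/
def closureCompl (G : SimpleGraph V) (u : V) (C : Set V) : Set (Set V) :=
  components G u \ domClosure G u C

/-- `C` is a master component of `u`. -/
def IsMaster (G : SimpleGraph V) (u : V) (C : Set V) : Prop :=
  C ∈ components G u ∧
    ∀ D ∈ components G u, (domClosure G u D).ncard ≤ (domClosure G u C).ncard

/-- `C` is a maximal component in the set `S` of components. -/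
def IsMaximalComp (G : SimpleGraph V) (S : Set (Set V)) (C : Set V) : Prop :=
  C ∈ S ∧ ∀ D ∈ S, ¬ nbhd G C ⊂ nbhd G D

/-- `(δ, δs)` is an admissible choice of the pair `(δ_u, δ_u^*)`. -/
def IsDelta (G : SimpleGraph V) (u : V) (δ δs : Set V) : Prop :=
  IsMaster G u δ ∧
    (closureCompl G u δ = ∅ → δs = ∅) ∧
    (closureCompl G u δ ≠ ∅ → IsMaximalComp G (closureCompl G u δ) δs)

/-- `x` is adjacent to (some vertex of) `S`. -/
def AdjTo (G : SimpleGraph V) (x : V) (S : Set V) : Prop :=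
  ∃ s ∈ S, G.Adj x s

/-- `N₁(u)`; the sets of neighbors are formed with the choices `δ` of `δ_u` and `δs` of
`δ_u^*`. -/
def N₁ (G : SimpleGraph V) (u : V) (δ δs : Set V) : Set V :=
  {x | G.Adj u x ∧ AdjTo G x δ ∧ ¬ AdjTo G x δs}

/-- `N₂(u)` -/
def N₂ (G : SimpleGraph V) (u : V) (δ δs : Set V) : Set V :=
  {x | G.Adj u x ∧ ¬ AdjTo G x δ ∧ AdjTo G x δs}

/-- `N₁₂(u)` -/
def N₁₂ (G : SimpleGraph V) (u : V) (δ δs : Set V) : Set V :=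
  {x | G.Adj u x ∧ AdjTo G x δ ∧ AdjTo G x δs}

/-- The vertices of the graph obtained by splitting `u`: the old vertices other than `u`, and the
two derivatives `u₁ = inr false` and `u₂ = inr true`. -/
abbrev SplitVert (u : V) : Type _ := {v : V // v ≠ u} ⊕ Bool

/-- The neighbors of the two derivatives of `u`. -/
def derivNbrs (G : SimpleGraph V) (u : V) (δ δs : Set V) : Bool → Set V
  | false => N₁ G u δ δs ∪ N₁₂ G u δ δs
  | true => N₂ G u δ δs ∪ N₁₂ G u δ δs

def splitAdj (G : SimpleGraph V) (u : V) (δ δs : Set V) : SplitVert u → SplitVert u → Prop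
  | Sum.inl a, Sum.inl b => G.Adj a.1 b.1
  | Sum.inl a, Sum.inr i => a.1 ∈ derivNbrs G u δ δs i
  | Sum.inr i, Sum.inl a => a.1 ∈ derivNbrs G u δ δs i
  | Sum.inr _, Sum.inr _ => False

/-- The graph `G^#(u)` obtained by the vertex splitting of `u`, for the choice `(δ, δs)`
of `(δ_u, δ_u^*)`. -/
def splitGraph (G : SimpleGraph V) (u : V) (δ δs : Set V) : SimpleGraph (SplitVert u) where
  Adj := splitAdj G u δ δs
  symm := ⟨by
    rintro (a | i) (b | j) h
    · exact SimpleGraph.Adj.symm h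
    · exact h
    · exact h
    · exact h⟩
  loopless := ⟨by
    rintro (a | i) h
    · exact G.loopless.irrefl _ h
    · exact h⟩

/-- The vertex of `G` from which a vertex of the split graph stems, given this information (`π`)
for the graph before the splitting. -/
def splitOrigin {W : Type u} (π : W → V) (w : W) : SplitVert w → V
  | Sum.inl a => π a.1
  | Sum.inr _ => π w

/-- `Reaches G x i W H π`: some run of the loop of Algorithm Split-`U`, with input `G` and
`U = {x 0, …, x (k-1)}`, has `H` as its graph `H_i`. The vertex set of `H` is `W`, and
`π : W → V` maps a vertex of `G` that has not been split to itself and both derivatives of a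
split vertex to that vertex. The choice of `(δ, δ^*)` is made anew, in the current graph, at each
step. -/
inductive Reaches (G : SimpleGraph V) {k : ℕ} (x : Fin k → V) :
    ℕ → (W : Type u) → SimpleGraph W → (W → V) → Prop
  | init : Reaches G x 0 V G id
  | step (i : Fin k) (W : Type u) (H : SimpleGraph W) (π : W → V) (w : W) (δ δs : Set W) :
      Reaches G x i W H π → π w = x i → IsDelta H w δ δs →
      Reaches G x (i + 1) (SplitVert w) (splitGraph H w δ δs) (splitOrigin π w)

/-- The vertices that remain when all unsplit vertices are removed from `H_k`. -/
abbrev FinalVert {k : ℕ} (x : Fin k → V) {W : Type u} (π : W → V) : Set W :=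
  {w | π w ∈ Set.range x}

/-- The returned graph `G^#(U)`. -/
abbrev finalGraph {k : ℕ} (x : Fin k → V) {W : Type u} (H : SimpleGraph W) (π : W → V) :
    SimpleGraph (FinalVert x π) :=
  H.induce (FinalVert x π)

/-- The map sending both derivatives of a vertex of `U` to that vertex. -/
def derivativeOf {k : ℕ} (x : Fin k → V) {W : Type u} (π : W → V) (w : FinalVert x π) :
    Set.range x :=
  ⟨π w.1, w.2⟩

end SplitU

/-!
In a trapezoid representation two trapezoids are disjoint exactly when one lies entirely to the left
of the other, and "entirely to the left of" is a strict order. Hence each component of `G \ N[u]`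
lies on one side of `u`. On each side, the component of a trapezoid closest to `u` dominates all
others: its neighborhood consists of all neighbors of `u` that have a neighbor on that side. So
`δ_u` and `δ_u^*` detect the two sides of `u`, and the derivatives of `u` are represented by two
segments, each squeezed against `u` on one side.

Every neighbor of such a derivative has neighbors entirely to the left and entirely to the right of
its segment. Therefore, by induction on the number of steps, a segment meets not only the current
object but also the original trapezoid of each of its neighbors. Two crossing segments, each beside
its own original trapezoid and meeting the other one, force two sides of the original trapezoids to
cross in the same direction. Thus every arc between two merged pairs is an arc of the given
representation, and acyclicity is inherited.
-/

theorem exists_between_notMem {α : Type*} [LinearOrder α] [DenselyOrdered α] [NoMinOrder α]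
    [NoMaxOrder α] [Nonempty α] {s t F : Set α} (hs : s.Finite) (ht : t.Finite) (hF : F.Finite)
    (hst : ∀ x ∈ s, ∀ y ∈ t, x < y) : ∃ m, (∀ x ∈ s, x < m) ∧ (∀ y ∈ t, m < y) ∧ m ∉ F := by
  classical
  lift s to Finset α using hs
  lift t to Finset α using ht
  lift F to Finset α using hF
  obtain ⟨m₀, hs₀, ht₀⟩ := Order.exists_between_finsets s t hst
  obtain ⟨m, hlo, hhi⟩ := Order.exists_between_finsets
    (s ∪ {x ∈ F | x ≤ m₀}) (t ∪ {x ∈ F | m₀ < x}) (by grind)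
  refine ⟨m, by grind, by grind, fun hm => ?_⟩
  rcases le_or_gt m m₀ with h | h
  · exact lt_irrefl m (hlo m (by grind))
  · exact lt_irrefl m (hhi m (by grind))

theorem card_eq_mul_of_ncard_fiber {α β : Type*} [Finite α] [Finite β] {f : α → β} {n : ℕ}
    (hf : ∀ b, (f ⁻¹' {b}).ncard = n) : Nat.card α = n * Nat.card β := by
  have := Fintype.ofFinite β
  calc Nat.card α = ∑ b, (f ⁻¹' {b}).ncard :=
        (Nat.card_congr (Equiv.sigmaFiberEquiv f)).symm.trans Nat.card_sigma
    _ = n * Nat.card β := by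
        simp only [hf, Finset.sum_const, Finset.card_univ, smul_eq_mul, Nat.card_eq_fintype_card,
          mul_comm]

/-! ### Trapezoids between the two lines -/

/-- A trapezoid between `L₁` and `L₂`, possibly degenerate, given by its corners on the upper and
the lower line; as in `TrapezoidRep`, the index `false` stands for left and `true` for right. -/
structure Trapezoid where
  top : Bool → ℝ
  bot : Bool → ℝ
  top_le : top false ≤ top true
  bot_le : bot false ≤ bot true

namespace Trapezoid

variable {A B : Trapezoid}

/-- `A < B` means that `A` lies entirely to the left of `B`; thus two trapezoids are disjoint if and
only if they are comparable. -/
instance : PartialOrder Trapezoid :=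
  @partialOrderOfSO Trapezoid (fun A B => A.top true < B.top false ∧ A.bot true < B.bot false)
    { irrefl := fun A h => h.1.not_ge A.top_le
      trans := fun _ B _ hAB hBC =>
        ⟨(hAB.1.trans_le B.top_le).trans hBC.1, (hAB.2.trans_le B.bot_le).trans hBC.2⟩ }

theorem lt_def : A < B ↔ A.top true < B.top false ∧ A.bot true < B.bot false := Iff.rfl

/-- A line segment, as a degenerate trapezoid. -/
def segment (a b : ℝ) : Trapezoid := ⟨fun _ => a, fun _ => b, le_rfl, le_rfl⟩

/-- The abscissa at height `t` of the left (`i = false`) or right (`i = true`) side. -/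
def side (A : Trapezoid) (i : Bool) (t : ℝ) : ℝ := (1 - t) * A.bot i + t * A.top i

/-- A trapezoid as a set of points of the plane. -/
def points (A : Trapezoid) : Set (ℝ × ℝ) :=
  {p | 0 ≤ p.2 ∧ p.2 ≤ 1 ∧ A.side false p.2 ≤ p.1 ∧ p.1 ≤ A.side true p.2}

theorem side_le_side (A : Trapezoid) {t : ℝ} (ht : t ∈ Set.Icc (0 : ℝ) 1) :
    A.side false t ≤ A.side true t :=
  add_le_add (mul_le_mul_of_nonneg_left A.bot_le (sub_nonneg.2 ht.2))
    (mul_le_mul_of_nonneg_left A.top_le ht.1)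

theorem side_lt_side_of_lt (h : A < B) {t : ℝ} (ht : t ∈ Set.Icc (0 : ℝ) 1) :
    A.side true t < B.side false t := by
  have hconvex : 0 < (1 - t) • (B.bot false - A.bot true) + t • (B.top false - A.top true) :=
    convex_Ioi (0 : ℝ) (sub_pos.2 h.2) (sub_pos.2 h.1) (sub_nonneg.2 ht.2) ht.1
      (sub_add_cancel 1 t)
  simp only [smul_eq_mul] at hconvex
  simp only [side]
  linarith

theorem points_inter_nonempty_iff_exists_height : (A.points ∩ B.points).Nonempty ↔
    ∃ t ∈ Set.Icc (0 : ℝ) 1, A.side false t ≤ B.side true t ∧ B.side false t ≤ A.side true t := by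
  constructor
  · rintro ⟨p, ⟨h0, h1, hA, hA'⟩, -, -, hB, hB'⟩
    exact ⟨p.2, ⟨h0, h1⟩, hA.trans hB', hB.trans hA'⟩
  · rintro ⟨t, ht, hAB, hBA⟩
    exact ⟨(max (A.side false t) (B.side false t), t),
      ⟨ht.1, ht.2, le_max_left _ _, max_le (A.side_le_side ht) hBA⟩,
      ⟨ht.1, ht.2, le_max_right _ _, max_le hAB (B.side_le_side ht)⟩⟩

theorem points_inter_nonempty_of_crossing (hbot : B.bot true ≤ A.bot false)
    (htop : A.top false ≤ B.top true) : (A.points ∩ B.points).Nonempty := by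
  have hcont : ContinuousOn (fun t => B.side true t - A.side false t) (Set.Icc 0 1) := by
    unfold side
    fun_prop
  obtain ⟨t, ht, hcross⟩ := intermediate_value_Icc zero_le_one hcont
    (show (0 : ℝ) ∈ _ by constructor <;> simpa [side])
  have heq : B.side true t = A.side false t := sub_eq_zero.1 hcross
  exact points_inter_nonempty_iff_exists_height.2
    ⟨t, ht, heq.ge, (B.side_le_side ht).trans (heq.le.trans (A.side_le_side ht))⟩

theorem points_inter_nonempty_iff :
    (A.points ∩ B.points).Nonempty ↔ IncompRel (· < ·) A B := by
  constructor
  · rw [points_inter_nonempty_iff_exists_height]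
    rintro ⟨t, ht, hAB, hBA⟩
    exact ⟨fun h => hBA.not_gt (side_lt_side_of_lt h ht),
      fun h => hAB.not_gt (side_lt_side_of_lt h ht)⟩
  · rintro ⟨hAB, hBA⟩
    rcases lt_or_ge (B.bot true) (A.bot false) with hbot | hbot
    · exact points_inter_nonempty_of_crossing hbot.le (not_lt.1 fun h => hBA ⟨h, hbot⟩)
    rcases lt_or_ge (A.bot true) (B.bot false) with hbot' | hbot'
    · rw [Set.inter_comm]
      exact points_inter_nonempty_of_crossing hbot'.le (not_lt.1 fun h => hAB ⟨h, hbot'⟩)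
    · exact points_inter_nonempty_iff_exists_height.2
        ⟨0, Set.left_mem_Icc.2 zero_le_one, by simpa [side], by simpa [side]⟩

/-- In each of the four cases the sides that cross are those facing the two segments. -/
theorem exists_crossing_sides {a b a' b' : ℝ} (hAB : IncompRel (· < ·) A B)
    (hA : segment a b < A ∨ A < segment a b) (hB : segment a' b' < B ∨ B < segment a' b')
    (hlB : IncompRel (· < ·) (segment a b) B) (hlA : IncompRel (· < ·) (segment a' b') A)
    (htop : a' < a) (hbot : b < b') :
    ∃ i j, B.top j ≤ A.top i ∧ A.bot i ≤ B.bot j := by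
  simp only [IncompRel, lt_def, segment, not_and_or, not_lt] at hAB hA hB hlA hlB
  rcases hA with hA | hA <;> rcases hB with hB | hB
  · exact ⟨false, false, by grind, by grind⟩
  · exact ⟨false, true, by grind, by grind⟩
  · exact ⟨true, false, by grind, by grind⟩
  · exact ⟨true, true, by grind, by grind⟩

theorem exists_segment_between {W : Type*} [Finite W] (S : W → Trapezoid) {P Q : Set W}
    (hPQ : ∀ p ∈ P, ∀ q ∈ Q, S p < S q) :
    ∃ a b, (∀ p ∈ P, S p < segment a b) ∧ (∀ q ∈ Q, segment a b < S q) ∧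
      (∀ w, (S w).top false ≠ a) ∧ ∀ w, (S w).bot false ≠ b := by
  obtain ⟨a, haP, haQ, ha⟩ := exists_between_notMem
    (P.toFinite.image fun p => (S p).top true) (Q.toFinite.image fun q => (S q).top false)
    (Set.finite_range fun w => (S w).top false)
    (by rintro _ ⟨p, hp, rfl⟩ _ ⟨q, hq, rfl⟩; exact (hPQ p hp q hq).1)
  obtain ⟨b, hbP, hbQ, hb⟩ := exists_between_notMem
    (P.toFinite.image fun p => (S p).bot true) (Q.toFinite.image fun q => (S q).bot false)
    (Set.finite_range fun w => (S w).bot false)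
    (by rintro _ ⟨p, hp, rfl⟩ _ ⟨q, hq, rfl⟩; exact (hPQ p hp q hq).2)
  rw [Set.forall_mem_image] at haP haQ hbP hbQ
  exact ⟨a, b, fun p hp => ⟨haP hp, hbP hp⟩, fun q hq => ⟨haQ hq, hbQ hq⟩,
    fun w h => ha ⟨w, h⟩, fun w h => hb ⟨w, h⟩⟩

end Trapezoid

namespace TrapezoidRep

variable {V : Type u} (R : TrapezoidRep V)

/-- The trapezoid of `v`, given by its corners. -/
def toTrapezoid (v : V) : Trapezoid :=
  ⟨fun i => R.lines.top (v, i), fun i => R.lines.bot (v, i), (R.top_lt v).le, (R.bot_lt v).le⟩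

theorem graph_adj {v w : V} : R.graph.Adj v w ↔
    v ≠ w ∧ IncompRel (· < ·) (R.toTrapezoid v) (R.toTrapezoid w) := by
  rw [← Trapezoid.points_inter_nonempty_iff]
  rfl

end TrapezoidRep

namespace PermRep

variable {W : Type u} (R : PermRep W) {x y : W}

theorem line_eq_points (w : W) :
    R.line w = (Trapezoid.segment (R.top w) (R.bot w)).points :=
  Set.ext fun _ => and_congr_right' (and_congr_right' (eq_comm.trans antisymm_iff.symm))

theorem graph_adj : R.graph.Adj x y ↔ x ≠ y ∧ IncompRel (· < ·)
    (Trapezoid.segment (R.top x) (R.bot x)) (Trapezoid.segment (R.top y) (R.bot y)) := by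
  rw [← Trapezoid.points_inter_nonempty_iff, ← R.line_eq_points, ← R.line_eq_points]
  rfl

theorem angle_eq (w : W) : R.angle w = Real.pi / 2 - Real.arctan (R.top w - R.bot w) := by
  rw [angle, Complex.arg_of_im_pos one_pos, Real.arccos_eq_pi_div_two_sub_arcsin,
    Real.arctan_eq_arcsin, Complex.norm_eq_sqrt_sq_add_sq, one_pow, add_comm]

theorem angle_lt_angle_iff : R.angle x < R.angle y ↔ R.top y - R.bot y < R.top x - R.bot x := by
  rw [angle_eq, angle_eq, sub_lt_sub_iff_left, Real.arctan_strictMono.lt_iff_lt]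

theorem orient_iff : R.orient x y ↔ R.top y < R.top x ∧ R.bot x < R.bot y := by
  rw [orient, graph_adj, angle_lt_angle_iff]
  simp only [IncompRel, Trapezoid.lt_def, Trapezoid.segment]
  have htop : x ≠ y → R.top x ≠ R.top y := R.top_injective.ne
  have hbot : x ≠ y → R.bot x ≠ R.bot y := R.bot_injective.ne
  grind

end PermRep


/-! ### Components and their neighborhoods -/

namespace SplitU

section Components

variable {W : Type u} {H : SimpleGraph W} {u x : W} {D δ δs : Set W}

theorem sUnion_components : ⋃₀ components H u = (insert u (H.neighborSet u))ᶜ := by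
  ext w
  constructor
  · rintro ⟨_, ⟨c, rfl⟩, w', -, rfl⟩
    exact w'.2
  · intro hw
    exact ⟨_, ⟨SimpleGraph.connectedComponentMk _ ⟨w, hw⟩, rfl⟩, ⟨w, hw⟩, rfl, rfl⟩

theorem nonempty_of_mem_components (hD : D ∈ components H u) : D.Nonempty := by
  obtain ⟨c, rfl⟩ := hD
  exact c.nonempty_supp.image _

theorem ne_of_mem_component (hD : D ∈ components H u) (hx : x ∈ D) : x ≠ u :=
  fun h => (sUnion_components.subset ⟨D, hD, hx⟩) (Or.inl h)

theorem not_adj_of_mem_component (hD : D ∈ components H u) (hx : x ∈ D) : ¬ H.Adj u x :=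
  fun h => (sUnion_components.subset ⟨D, hD, hx⟩) (Or.inr h)

theorem mem_component_of_adj (hD : D ∈ components H u) {y : W} (hx : x ∈ D) (hxy : H.Adj x y)
    (hyu : y ≠ u) (hy : ¬ H.Adj u y) : y ∈ D := by
  obtain ⟨c, rfl⟩ := hD
  obtain ⟨x, hxc, rfl⟩ := hx
  exact ⟨⟨y, by simp [hyu, hy]⟩, c.mem_supp_of_adj_mem_supp hxc hxy, rfl⟩

theorem forall_mem_component {p : W → Prop} (hD : D ∈ components H u) (hx : x ∈ D) (hp : p x)
    (hadj : ∀ y ∈ D, ∀ z ∈ D, H.Adj y z → p y → p z) : ∀ y ∈ D, p y := by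
  obtain ⟨c, rfl⟩ := hD
  obtain ⟨x, hxc, rfl⟩ := hx
  rintro _ ⟨y, hyc, rfl⟩
  obtain ⟨walk⟩ := c.reachable_of_mem_supp hxc hyc
  induction walk with
  | nil => exact hp
  | cons h _ ih =>
    have hv := c.mem_supp_of_adj_mem_supp hxc h
    exact ih hv (hadj _ ⟨_, hxc, rfl⟩ _ ⟨_, hv, rfl⟩ h hp) hyc

theorem mem_nbhd_iff (hD : D ∈ components H u) :
    x ∈ nbhd H D ↔ H.Adj u x ∧ AdjTo H x D := by
  simp only [nbhd, AdjTo, Set.mem_sdiff, Set.mem_iUnion, SimpleGraph.mem_neighborSet,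
    exists_prop, H.adj_comm x]
  constructor
  · rintro ⟨⟨d, hd, hdx⟩, hxD⟩
    have hxu : x ≠ u := by
      rintro rfl
      exact not_adj_of_mem_component hD hd hdx.symm
    exact ⟨by_contra fun h => hxD (mem_component_of_adj hD hd hdx hxu h), d, hd, hdx⟩
  · rintro ⟨hux, hd⟩
    exact ⟨hd, fun hxD => not_adj_of_mem_component hD hxD hux⟩

theorem nbhd_empty : nbhd H ∅ = ∅ := by simp [nbhd]

theorem IsMaster.nbhd_eq_of_subset [Finite W] (hδ : IsMaster H u δ) (hD : D ∈ components H u)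
    (h : nbhd H δ ⊆ nbhd H D) : nbhd H D = nbhd H δ := by
  have hclosure : domClosure H u δ = domClosure H u D :=
    Set.eq_of_subset_of_ncard_le (fun _ hC => ⟨hC.1, hC.2.trans h⟩) (hδ.2 D hD)
  exact Set.Subset.antisymm (hclosure.superset ⟨hD, subset_rfl⟩).2 h

theorem IsMaximalComp.nbhd_eq_of_subset {S : Set (Set W)} (hδ : IsMaximalComp H S δ) (hD : D ∈ S)
    (h : nbhd H δ ⊆ nbhd H D) : nbhd H D = nbhd H δ :=
  (eq_of_le_of_not_lt h (hδ.2 D hD)).symm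

namespace IsDelta

theorem isMaximalComp (h : IsDelta H u δ δs) (hδs : δs.Nonempty) :
    IsMaximalComp H (closureCompl H u δ) δs :=
  h.2.2 fun hempty => hδs.ne_empty (h.2.1 hempty)

theorem derivNbrs_false (h : IsDelta H u δ δs) : derivNbrs H u δ δs false = nbhd H δ := by
  ext x
  simp only [derivNbrs, N₁, N₁₂, Set.mem_union, Set.mem_ofPred_eq, mem_nbhd_iff h.1.1]
  tauto

theorem derivNbrs_true (h : IsDelta H u δ δs) : derivNbrs H u δ δs true = nbhd H δs := by
  rcases δs.eq_empty_or_nonempty with rfl | hδs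
  · simp [derivNbrs, N₂, N₁₂, AdjTo, nbhd_empty]
  · ext x
    simp only [derivNbrs, N₂, N₁₂, Set.mem_union, Set.mem_ofPred_eq,
      mem_nbhd_iff (h.isMaximalComp hδs).1.1]
    tauto

end IsDelta

theorem exists_isDelta [Finite W] (h : (components H u).Nonempty) :
    ∃ δ δs, IsDelta H u δ δs := by
  obtain ⟨δ, hδ, hmax⟩ := Set.exists_max_image _ (fun D => (domClosure H u D).ncard)
    (components H u).toFinite h
  rcases (closureCompl H u δ).eq_empty_or_nonempty with hempty | hne
  · exact ⟨δ, ∅, ⟨hδ, hmax⟩, fun _ => rfl, fun h => (h hempty).elim⟩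
  · obtain ⟨δs, hδs⟩ := (closureCompl H u δ).toFinite.exists_maximalFor (nbhd H) _ hne
    exact ⟨δ, δs, ⟨hδ, hmax⟩, fun h => (hne.ne_empty h).elim,
      fun _ => ⟨hδs.prop, fun D hD => hδs.not_gt hD⟩⟩

theorem adj_of_mem_derivNbrs {i : Bool} (hx : x ∈ derivNbrs H u δ δs i) : H.Adj u x := by
  cases i <;> exact hx.elim And.left And.left

end Components

/-! ### The two sides of a vertex in an order representation -/

section Representations

variable {W : Type u} {α : Type*} [PartialOrder α] {S : W → α} {H : SimpleGraph W} {u x y : W}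
  {D δ δs : Set W}

/-- `S` represents `H` as an incomparability graph. For `α = Trapezoid` this says that `S` is a
trapezoid representation, except that endpoints need not be distinct. -/
def Represents (S : W → α) (H : SimpleGraph W) : Prop :=
  ∀ x y, H.Adj x y ↔ x ≠ y ∧ IncompRel (· < ·) (S x) (S y)

/-- The neighbors of `u` that have a neighbor to the left of `u`. -/
def leftNbrs (S : W → α) (H : SimpleGraph W) (u : W) : Set W :=
  {x | H.Adj u x ∧ ∃ z, H.Adj x z ∧ S z < S u}

/-- The neighbors of `u` that have a neighbor to the right of `u`; being defined by reversing the
order, it inherits the properties of `leftNbrs`. -/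
def rightNbrs (S : W → α) (H : SimpleGraph W) (u : W) : Set W :=
  leftNbrs (OrderDual.toDual ∘ S) H u

theorem nbhd_subset_leftNbrs (hD : D ∈ components H u) (hleft : ∀ y ∈ D, S y < S u) :
    nbhd H D ⊆ leftNbrs S H u := fun x hx => by
  obtain ⟨hux, d, hd, hxd⟩ := (mem_nbhd_iff hD).1 hx
  exact ⟨hux, d, hxd, hleft d hd⟩

namespace Represents

variable (hS : Represents S H)

include hS

theorem dual : Represents (OrderDual.toDual ∘ S) H := fun x y =>
  (hS x y).trans (and_congr_right' incompRel_comm)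

theorem not_adj_of_lt (h : S x < S y) : ¬ H.Adj x y := fun hxy => ((hS x y).1 hxy).2.1 h

theorem lt_or_gt (hxy : x ≠ y) (h : ¬ H.Adj x y) : S x < S y ∨ S y < S x := by
  by_contra! hlt
  exact h ((hS x y).2 ⟨hxy, hlt⟩)

theorem component_lt (hD : D ∈ components H u) (hx : x ∈ D) (hxu : S x < S u) :
    ∀ y ∈ D, S y < S u := by
  refine forall_mem_component hD hx hxu fun y _ z hz hyz hyu => ?_
  refine (hS.lt_or_gt (ne_of_mem_component hD hz)
    fun h => not_adj_of_mem_component hD hz h.symm).resolve_right fun huz => ?_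
  exact hS.not_adj_of_lt (hyu.trans huz) hyz

theorem component_lt_or_gt (hD : D ∈ components H u) :
    (∀ y ∈ D, S y < S u) ∨ ∀ y ∈ D, S u < S y := by
  obtain ⟨x, hx⟩ := nonempty_of_mem_components hD
  exact (hS.lt_or_gt (ne_of_mem_component hD hx)
    fun h => not_adj_of_mem_component hD hx h.symm).imp (hS.component_lt hD hx)
    (hS.dual.component_lt hD hx)

/-- The witness is the component of a maximal vertex to the left of `u`. -/
theorem exists_nbhd_eq_leftNbrs [Finite W] (h : ∃ z, S z < S u) :
    ∃ D ∈ components H u, (∀ y ∈ D, S y < S u) ∧ nbhd H D = leftNbrs S H u := by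
  obtain ⟨m, hm⟩ := (Set.toFinite {z | S z < S u}).exists_maximalFor S _ h
  have hmu : S m < S u := hm.prop
  obtain ⟨D, hD, hmD⟩ : m ∈ ⋃₀ components H u := by
    rw [sUnion_components]
    rintro (rfl | h)
    · exact hmu.false
    · exact hS.not_adj_of_lt hmu h.symm
  have hleft := hS.component_lt hD hmD hmu
  refine ⟨D, hD, hleft, (nbhd_subset_leftNbrs hD hleft).antisymm ?_⟩
  rintro x ⟨hux, z, hxz, hzu⟩
  refine (mem_nbhd_iff hD).2 ⟨hux, ?_⟩
  by_cases hxm : H.Adj x m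
  · exact ⟨m, hmD, hxm⟩
  have hmx : S m < S x := by
    refine (hS.lt_or_gt ?_ hxm).resolve_left fun hlt => hS.not_adj_of_lt (hlt.trans hmu) hux.symm
    rintro rfl
    exact hS.not_adj_of_lt hmu hux.symm
  have hmz : H.Adj m z := (hS m z).2 ⟨?_, hm.not_gt hzu, fun hzm => ?_⟩
  · exact ⟨z, mem_component_of_adj hD hmD hmz (fun h => hzu.ne (congrArg S h))
      fun h => hS.not_adj_of_lt hzu h.symm, hxz⟩
  · rintro rfl
    exact hxm hxz
  · exact hS.not_adj_of_lt (hzm.trans hmx) hxz.symm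

theorem nbhd_eq_of_isDelta_left [Finite W] (hδ : IsDelta H u δ δs)
    (hleft : ∀ y ∈ δ, S y < S u) :
    nbhd H δ = leftNbrs S H u ∧ (nbhd H δs = rightNbrs S H u ∨ nbhd H δs = ∅) := by
  obtain ⟨y, hy⟩ := nonempty_of_mem_components hδ.1.1
  obtain ⟨L, hL, -, hLeq⟩ := hS.exists_nbhd_eq_leftNbrs ⟨y, hleft y hy⟩
  have hδL : nbhd H δ = leftNbrs S H u := by
    rw [← hLeq]
    exact (hδ.1.nbhd_eq_of_subset hL (hLeq ▸ nbhd_subset_leftNbrs hδ.1.1 hleft)).symm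
  refine ⟨hδL, or_iff_not_imp_right.2 fun hne => ?_⟩
  have hmax := hδ.isMaximalComp (Set.nonempty_iff_ne_empty.2 fun h => hne (by rw [h, nbhd_empty]))
  have hright := (hS.component_lt_or_gt hmax.1.1).resolve_left fun h =>
    hmax.1.2 ⟨hmax.1.1, hδL ▸ nbhd_subset_leftNbrs hmax.1.1 h⟩
  obtain ⟨z, hz⟩ := nonempty_of_mem_components hmax.1.1
  obtain ⟨D, hD, -, hDeq⟩ := hS.dual.exists_nbhd_eq_leftNbrs ⟨z, hright z hz⟩
  have hsub : nbhd H δs ⊆ nbhd H D := hDeq ▸ nbhd_subset_leftNbrs hmax.1.1 hright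
  have hDmem : D ∈ closureCompl H u δ := ⟨hD, fun h => hmax.1.2 ⟨hmax.1.1, hsub.trans h.2⟩⟩
  exact (hmax.nbhd_eq_of_subset hDmem hsub).symm.trans hDeq

end Represents

theorem IsDelta.exists_derivNbrs_eq [Finite W] (hδ : IsDelta H u δ δs) (hS : Represents S H) :
    ∃ i, (derivNbrs H u δ δs i = leftNbrs S H u ∨ derivNbrs H u δ δs i = ∅) ∧
      (derivNbrs H u δ δs (!i) = rightNbrs S H u ∨ derivNbrs H u δ δs (!i) = ∅) := by
  rcases hS.component_lt_or_gt hδ.1.1 with hleft | hright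
  · refine ⟨false, ?_⟩
    rw [Bool.not_false, hδ.derivNbrs_false, hδ.derivNbrs_true]
    exact (hS.nbhd_eq_of_isDelta_left hδ hleft).imp_left Or.inl
  · refine ⟨true, ?_⟩
    rw [Bool.not_true, hδ.derivNbrs_false, hδ.derivNbrs_true]
    exact (hS.dual.nbhd_eq_of_isDelta_left hδ hright).symm.imp_right Or.inl

end Representations

/-! ### Lines that replace a split vertex -/

section DerivativeLines

variable {W : Type u} {α : Type*} [PartialOrder α] {S : W → α} {H : SimpleGraph W} {u x : W}
  {N δ δs : Set W} {ℓ : α}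

/-- `ℓ` can represent, beside the representation `S` of `H - u`, a derivative of `u` with
neighborhood `N`. The two neighbors of each `x ∈ N` on either side of `ℓ` do not only make `ℓ` meet
`S x`; they make it meet everything met by all neighbors of `x`. -/
structure IsDerivLine (S : W → α) (H : SimpleGraph W) (u : W) (N : Set W) (ℓ : α) : Prop where
  lt_or_gt : ℓ < S u ∨ S u < ℓ
  exists_adj_lt : ∀ x ∈ N, ∃ z, H.Adj x z ∧ S z < ℓ
  exists_adj_gt : ∀ x ∈ N, ∃ z, H.Adj x z ∧ ℓ < S z
  mem_of_incompRel : ∀ x ≠ u, IncompRel (· < ·) (S x) ℓ → x ∈ N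

namespace IsDerivLine

theorem of_dual {ℓ : αᵒᵈ} (h : IsDerivLine (OrderDual.toDual ∘ S) H u N ℓ) :
    IsDerivLine S H u N (OrderDual.ofDual ℓ) where
  lt_or_gt := h.lt_or_gt.symm
  exists_adj_lt := h.exists_adj_gt
  exists_adj_gt := h.exists_adj_lt
  mem_of_incompRel := fun x hx hxℓ => h.mem_of_incompRel x hx hxℓ.symm

theorem incompRel_of_forall_adj (h : IsDerivLine S H u N ℓ) (hx : x ∈ N) {τ : α}
    (hτ : ∀ z, H.Adj x z → IncompRel (· < ·) (S z) τ) : IncompRel (· < ·) ℓ τ := by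
  obtain ⟨z, hxz, hz⟩ := h.exists_adj_lt x hx
  obtain ⟨z', hxz', hz'⟩ := h.exists_adj_gt x hx
  exact ⟨fun hlt => (hτ z hxz).1 (hz.trans hlt), fun hlt => (hτ z' hxz').2 (hlt.trans hz')⟩

theorem mem_iff (h : IsDerivLine S H u N ℓ) (hS : Represents S H) (hx : x ≠ u) :
    x ∈ N ↔ IncompRel (· < ·) (S x) ℓ :=
  ⟨fun hxN => (h.incompRel_of_forall_adj hxN fun z hxz => ((hS x z).1 hxz).2.symm).symm,
    h.mem_of_incompRel x hx⟩

end IsDerivLine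

namespace Represents

variable (hS : Represents S H)

include hS

theorem exists_cut_leftNbrs (hN : N = leftNbrs S H u ∨ N = ∅) :
    ∃ P Q : Set W, u ∈ Q ∧ (∀ p ∈ P, ∀ q ∈ Q, S p < S q) ∧
      ∀ ℓ, (∀ p ∈ P, S p < ℓ) → (∀ q ∈ Q, ℓ < S q) → IsDerivLine S H u N ℓ := by
  rcases hN with rfl | rfl
  · have hu : ¬ S u < S u ∧ ∀ z, S z < S u → ¬ H.Adj u z :=
      ⟨lt_irrefl _, fun z hz h => hS.not_adj_of_lt hz h.symm⟩
    refine ⟨{z | S z < S u}, {x | ¬ S x < S u ∧ ∀ z, S z < S u → ¬ H.Adj x z}, hu, ?_, ?_⟩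
    · rintro p hp q ⟨hqu, hq⟩
      refine (hS.lt_or_gt ?_ (hq p hp)).resolve_left fun hqp => hqu (hqp.trans hp)
      rintro rfl
      exact hqu hp
    · intro ℓ hP hQ
      have hℓu : ℓ < S u := hQ u hu
      refine ⟨Or.inl hℓu, fun x ⟨_, z, hxz, hz⟩ => ⟨z, hxz, hP z hz⟩,
        fun x hx => ⟨u, hx.1.symm, hℓu⟩, fun x hxu hx => ?_⟩
      have hxlt : ¬ S x < S u := fun h => hx.1 (hP x h)
      obtain ⟨z, hz, hxz⟩ : ∃ z, S z < S u ∧ H.Adj x z := by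
        by_contra! h
        exact hx.2 (hQ x ⟨hxlt, h⟩)
      refine ⟨by_contra fun hux => ?_, z, hxz, hz⟩
      have hlt := (hS.lt_or_gt hxu.symm hux).resolve_right hxlt
      exact hS.not_adj_of_lt (hz.trans hlt) hxz.symm
  · exact ⟨∅, Set.univ, trivial, by simp, fun ℓ _ hQ => ⟨Or.inl (hQ u trivial), by simp, by simp,
      fun x _ hx => (hx.2 (hQ x trivial)).elim⟩⟩

theorem exists_cut_rightNbrs (hN : N = rightNbrs S H u ∨ N = ∅) :
    ∃ P Q : Set W, u ∈ P ∧ (∀ p ∈ P, ∀ q ∈ Q, S p < S q) ∧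
      ∀ ℓ, (∀ p ∈ P, S p < ℓ) → (∀ q ∈ Q, ℓ < S q) → IsDerivLine S H u N ℓ := by
  obtain ⟨Q, P, hu, hPQ, hℓ⟩ := hS.dual.exists_cut_leftNbrs hN
  exact ⟨P, Q, hu, fun p hp q hq => hPQ q hq p hp, fun ℓ hP hQ => (hℓ ℓ hQ hP).of_dual⟩

theorem split {ℓ : Bool → α} (hℓ : ∀ i, IsDerivLine S H u (derivNbrs H u δ δs i) (ℓ i))
    (hlt : Pairwise fun i j => ℓ i < ℓ j ∨ ℓ j < ℓ i) :
    Represents (Sum.elim (fun w : {w // w ≠ u} => S w) ℓ) (splitGraph H u δ δs) := by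
  rintro (x | i) (y | j)
  · exact (hS x y).trans
      (and_congr_left' (Sum.inl_injective.ne_iff.trans Subtype.coe_ne_coe.symm).symm)
  · exact ((hℓ j).mem_iff hS x.2).trans (and_iff_right Sum.inl_ne_inr).symm
  · exact ((hℓ i).mem_iff hS y.2).trans
      (incompRel_comm.trans (and_iff_right Sum.inr_ne_inl).symm)
  · refine iff_of_false id fun ⟨hne, hij⟩ => ?_
    exact (hlt fun h => hne (congrArg _ h)).elim hij.1 hij.2

end Represents

theorem IsDelta.exists_derivLines [Finite W] {S : W → Trapezoid} (hδ : IsDelta H u δ δs)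
    (hS : Represents S H) :
    ∃ a b : Bool → ℝ,
      (∀ i, IsDerivLine S H u (derivNbrs H u δ δs i) (Trapezoid.segment (a i) (b i))) ∧
      (Pairwise fun i j => Trapezoid.segment (a i) (b i) < Trapezoid.segment (a j) (b j) ∨
        Trapezoid.segment (a j) (b j) < Trapezoid.segment (a i) (b i)) ∧
      (∀ w i, (S w).top false ≠ a i) ∧ ∀ w i, (S w).bot false ≠ b i := by
  obtain ⟨l, hl, hr⟩ := hδ.exists_derivNbrs_eq hS
  have hex : ∀ i, ∃ a b, IsDerivLine S H u (derivNbrs H u δ δs i) (Trapezoid.segment a b) ∧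
      (i = l ∧ Trapezoid.segment a b < S u ∨ i ≠ l ∧ S u < Trapezoid.segment a b) ∧
      (∀ w, (S w).top false ≠ a) ∧ ∀ w, (S w).bot false ≠ b := fun i => by
    rcases Bool.eq_or_eq_not i l with rfl | rfl
    · obtain ⟨P, Q, hu, hPQ, hline⟩ := hS.exists_cut_leftNbrs hl
      obtain ⟨a, b, hP, hQ, hab⟩ := Trapezoid.exists_segment_between S hPQ
      exact ⟨a, b, hline _ hP hQ, Or.inl ⟨rfl, hQ u hu⟩, hab⟩
    · obtain ⟨P, Q, hu, hPQ, hline⟩ := hS.exists_cut_rightNbrs hr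
      obtain ⟨a, b, hP, hQ, hab⟩ := Trapezoid.exists_segment_between S hPQ
      exact ⟨a, b, hline _ hP hQ, Or.inr ⟨Bool.not_ne_self l, hP u hu⟩, hab⟩
  choose a b hline hside ha hb using hex
  refine ⟨a, b, hline, fun i j hij => ?_, fun w i => ha i w, fun w i => hb i w⟩
  rcases hside i with ⟨hi, hiu⟩ | ⟨hi, hiu⟩ <;> rcases hside j with ⟨hj, hju⟩ | ⟨hj, hju⟩
  · exact (hij (hi.trans hj.symm)).elim
  · exact Or.inl (hiu.trans hju)
  · exact Or.inr (hju.trans hiu)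
  · exact (hij ((Bool.eq_not_of_ne hi).trans (Bool.eq_not_of_ne hj).symm)).elim

end DerivativeLines

/-! ### The invariant of the splitting -/

/-- Invariant of the loop of Algorithm Split-`U`, started with the trapezoids `T`: `S` represents
the current graph `H`, with the trapezoid `T v` of each vertex `v ∈ done` replaced by two segments
beside it, one for each derivative of `v`. -/
structure IsSplitRep {V W : Type u} (T : V → Trapezoid) (H : SimpleGraph W) (π : W → V)
    (S : W → Trapezoid) (done : Set V) : Prop where
  represents : Represents S H
  incompRel_origin : ∀ w x, H.Adj w x → IncompRel (· < ·) (S w) (T (π x))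
  eq_of_notMem : ∀ w, π w ∉ done → S w = T (π w)
  eq_segment : ∀ w, π w ∈ done → ∃ a b, S w = Trapezoid.segment a b
  lt_or_gt : ∀ w, π w ∈ done → S w < T (π w) ∨ T (π w) < S w
  top_injective : Function.Injective ((Trapezoid.top · false) ∘ S)
  bot_injective : Function.Injective ((Trapezoid.bot · false) ∘ S)

namespace IsSplitRep

variable {V W : Type u} {T : V → Trapezoid} {H : SimpleGraph W} {π : W → V} {S : W → Trapezoid}
  {done : Set V} {u : W} {δ δs : Set W}

theorem of_trapezoidRep (R : TrapezoidRep V) :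
    IsSplitRep R.toTrapezoid R.graph id R.toTrapezoid ∅ where
  represents _ _ := R.graph_adj
  incompRel_origin _ _ h := (R.graph_adj.1 h).2
  eq_of_notMem _ _ := rfl
  eq_segment _ h := h.elim
  lt_or_gt _ h := h.elim
  top_injective := R.lines.top_injective.comp (Prod.mk_left_injective false)
  bot_injective := R.lines.bot_injective.comp (Prod.mk_left_injective false)

theorem split [Finite W] (h : IsSplitRep T H π S done) (hu : π u ∉ done)
    (hfiber : ∀ w, π w = π u → w = u) (hδ : IsDelta H u δ δs) :
    ∃ S', IsSplitRep T (splitGraph H u δ δs) (splitOrigin π u) S' (insert (π u) done) := by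
  obtain ⟨a, b, hline, hlt, ha, hb⟩ := hδ.exists_derivLines h.represents
  have hold : ∀ w : {w // w ≠ u}, π w ≠ π u := fun w hw => w.2 (hfiber w hw)
  refine ⟨Sum.elim (fun w => S w) fun i => Trapezoid.segment (a i) (b i),
    h.represents.split hline hlt, ?_, ?_, ?_, ?_, ?_, ?_⟩
  · rintro (w | i) (x | j) hadj
    · exact h.incompRel_origin w x hadj
    · exact h.incompRel_origin w u (adj_of_mem_derivNbrs hadj).symm
    · exact (hline i).incompRel_of_forall_adj hadj fun z hz => h.incompRel_origin z x hz.symm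
    · exact hadj.elim
  · rintro (w | i) hw
    · exact h.eq_of_notMem w fun hmem => hw (Or.inr hmem)
    · exact (hw (Or.inl rfl)).elim
  · rintro (w | i) hw
    · exact h.eq_segment w (hw.resolve_left (hold w))
    · exact ⟨a i, b i, rfl⟩
  · rintro (w | i) hw
    · exact h.lt_or_gt w (hw.resolve_left (hold w))
    · have := (hline i).lt_or_gt
      rwa [h.eq_of_notMem u hu] at this
  · rw [Sum.comp_elim]
    exact (h.top_injective.comp Subtype.val_injective).sumElim (Function.injective_iff_pairwise_ne.2
      (hlt.mono fun i j => Or.rec (fun hij => hij.1.ne) fun hij => hij.1.ne')) fun w i => ha w i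
  · rw [Sum.comp_elim]
    exact (h.bot_injective.comp Subtype.val_injective).sumElim (Function.injective_iff_pairwise_ne.2
      (hlt.mono fun i j => Or.rec (fun hij => hij.2.ne) fun hij => hij.2.ne')) fun w i => hb w i

variable {k : ℕ} {x : Fin k → V}

/-- The segments of the derivatives, as a permutation representation. -/
def permRep (h : IsSplitRep T H π S (Set.range x)) : PermRep (FinalVert x π) where
  top w := (S w).top false
  bot w := (S w).bot false
  top_injective := h.top_injective.comp Subtype.val_injective
  bot_injective := h.bot_injective.comp Subtype.val_injective

variable (h : IsSplitRep T H π S (Set.range x))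

theorem segment_permRep (w : FinalVert x π) :
    Trapezoid.segment (h.permRep.top w) (h.permRep.bot w) = S w := by
  obtain ⟨a, b, hab⟩ := h.eq_segment w w.2
  simp only [permRep, hab, Trapezoid.segment]

theorem graph_permRep : h.permRep.graph = finalGraph x H π := by
  ext v w
  rw [PermRep.graph_adj, h.segment_permRep, h.segment_permRep, ← Subtype.coe_ne_coe]
  exact (h.represents v w).symm

theorem mergedArc_of_permRep {R : TrapezoidRep V}
    (h : IsSplitRep R.toTrapezoid H π S (Set.range x))
    (hadj : ∀ w y, H.Adj w y → R.graph.Adj (π w) (π y)) {p q : Set.range x}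
    (harc : h.permRep.mergedArc (derivativeOf x π) p q) :
    R.lines.mergedArc Prod.fst (p : V) q := by
  obtain ⟨-, v, w, rfl, rfl, horient⟩ := harc
  have hvw : H.Adj v w := h.graph_permRep.le horient.1
  obtain ⟨htop, hbot⟩ := h.permRep.orient_iff.1 horient
  obtain ⟨hπ, hmeet⟩ := R.graph_adj.1 (hadj _ _ hvw)
  obtain ⟨i, j, hij, hij'⟩ := Trapezoid.exists_crossing_sides hmeet
    (h.segment_permRep v ▸ h.lt_or_gt v v.2) (h.segment_permRep w ▸ h.lt_or_gt w w.2)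
    (h.segment_permRep v ▸ h.incompRel_origin v w hvw)
    (h.segment_permRep w ▸ h.incompRel_origin w v hvw.symm) htop hbot
  have hsides : (π v, i) ≠ (π w, j) := fun heq => hπ (congrArg Prod.fst heq)
  exact ⟨hπ, _, _, rfl, rfl, R.lines.orient_iff.2
    ⟨hij.lt_of_ne (R.lines.top_injective.ne hsides).symm,
      hij'.lt_of_ne (R.lines.bot_injective.ne hsides)⟩⟩

theorem isAcyclic_permRep {R : TrapezoidRep V}
    (h : IsSplitRep R.toTrapezoid H π S (Set.range x))
    (hadj : ∀ w y, H.Adj w y → R.graph.Adj (π w) (π y)) (hR : R.lines.IsAcyclic Prod.fst) :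
    h.permRep.IsAcyclic (derivativeOf x π) := fun p hp =>
  hR p (hp.lift Subtype.val fun _ _ => h.mergedArc_of_permRep hadj)

end IsSplitRep

/-! ### Runs of the algorithm -/

section Runs

variable {V W : Type u} {G : SimpleGraph V} {H : SimpleGraph W} {π : W → V} {u : W} {k i : ℕ}
  {x : Fin k → V}

/-- The vertices split in the first `i` steps. -/
def splitSet (x : Fin k → V) (i : ℕ) : Set V := x '' {j | (j : ℕ) < i}

theorem splitSet_zero : splitSet x 0 = ∅ := by simp [splitSet]

theorem splitSet_succ (i : Fin k) : splitSet x (i + 1) = insert (x i) (splitSet x i) := by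
  have hle : {j : Fin k | (j : ℕ) < i + 1} = insert i {j : Fin k | (j : ℕ) < i} := by
    ext j
    simp only [Set.mem_ofPred_eq, Set.mem_insert_iff, Fin.ext_iff]
    lia
  rw [splitSet, hle, Set.image_insert_eq, splitSet]

theorem splitSet_last : splitSet x k = Set.range x := by simp [splitSet]

theorem notMem_splitSet (hx : Function.Injective x) (i : Fin k) : x i ∉ splitSet x i :=
  fun h => lt_irrefl (i : ℕ) (hx.mem_set_image.1 h)

theorem fiber_splitOrigin_self (hu : ∀ w, π w = π u → w = u) :
    splitOrigin π u ⁻¹' {π u} = Set.range Sum.inr := by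
  ext (w | i)
  · simpa [splitOrigin] using fun h => w.2 (hu w h)
  · simp [splitOrigin]

theorem fiber_splitOrigin_of_ne {v : V} (hv : v ≠ π u) :
    splitOrigin π u ⁻¹' {v} = Sum.inl '' (Subtype.val ⁻¹' (π ⁻¹' {v})) := by
  ext (w | i)
  · simp [splitOrigin]
  · simpa [splitOrigin] using hv.symm

namespace Reaches

theorem finite [Finite V] (h : Reaches G x i W H π) : Finite W := by
  induction h with
  | init => infer_instance
  | step => infer_instance

theorem surjective (h : Reaches G x i W H π) : Function.Surjective π := by
  induction h with
  | init => exact Function.surjective_id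
  | step _ _ _ π u _ _ _ _ _ ih =>
    intro v
    obtain ⟨w, rfl⟩ := ih v
    by_cases hw : w = u
    · exact ⟨Sum.inr false, by rw [hw]; rfl⟩
    · exact ⟨Sum.inl ⟨w, hw⟩, rfl⟩

theorem adj (h : Reaches G x i W H π) : ∀ {a b : W}, H.Adj a b → G.Adj (π a) (π b) := by
  induction h with
  | init => exact id
  | step _ _ _ _ _ _ _ _ _ _ ih =>
    rintro (a | i) (b | j) hab
    · exact ih hab
    · exact ih (adj_of_mem_derivNbrs hab).symm
    · exact ih (adj_of_mem_derivNbrs hab)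
    · exact hab.elim

theorem exists_isDelta [Finite V] (h : Reaches G x i W H π) {v : V}
    (hv : (components G v).Nonempty) : ∃ u, π u = v ∧ ∃ δ δs, IsDelta H u δ δs := by
  have := h.finite
  obtain ⟨u, rfl⟩ := h.surjective v
  obtain ⟨D, hD⟩ := hv
  obtain ⟨y, hy⟩ := nonempty_of_mem_components hD
  obtain ⟨w, rfl⟩ := h.surjective y
  have hw : w ∈ ⋃₀ components H u := by
    rw [sUnion_components]
    rintro (rfl | huw)
    · exact ne_of_mem_component hD hy rfl
    · exact not_adj_of_mem_component hD hy (h.adj huw)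
  obtain ⟨C, hC, -⟩ := hw
  exact ⟨u, rfl, SplitU.exists_isDelta ⟨C, hC⟩⟩

theorem eq_of_origin_eq (h : Reaches G x i W H π) :
    ∀ {a b : W}, π a ∉ splitSet x i → π b = π a → b = a := by
  induction h with
  | init => exact fun _ hab => hab
  | step _ _ _ _ _ _ _ _ hu _ ih =>
    rw [splitSet_succ, ← hu]
    rintro (a | _) (b | _) ha hab
    · exact congrArg Sum.inl (Subtype.ext (ih (fun hmem => ha (Or.inr hmem)) hab))
    · exact (ha (Or.inl hab.symm)).elim
    all_goals exact (ha (Or.inl rfl)).elim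

theorem ncard_fiber (hx : Function.Injective x) (h : Reaches G x i W H π) :
    ∀ v ∈ splitSet x i, (π ⁻¹' {v}).ncard = 2 := by
  induction h with
  | init => simp [splitSet_zero]
  | step i _ _ π u _ _ h hu _ ih =>
    rw [splitSet_succ, ← hu]
    intro v hv
    rcases eq_or_ne v (π u) with rfl | hvu
    · rw [fiber_splitOrigin_self fun w => h.eq_of_origin_eq (hu ▸ notMem_splitSet hx i),
        ← Set.image_univ, Set.ncard_image_of_injective _ Sum.inr_injective, Set.ncard_univ,
        Nat.card_eq_fintype_card, Fintype.card_bool]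
    · rw [fiber_splitOrigin_of_ne hvu, Set.ncard_image_of_injective _ Sum.inl_injective,
        Set.ncard_preimage_of_injective_subset_range Subtype.val_injective,
        ih v (hv.resolve_left hvu)]
      rintro w rfl
      exact ⟨⟨w, fun hwu => hvu (congrArg π hwu)⟩, rfl⟩

theorem exists_isSplitRep [Finite V] {R : TrapezoidRep V} (hx : Function.Injective x)
    (h : Reaches R.graph x i W H π) :
    ∃ S, IsSplitRep R.toTrapezoid H π S (splitSet x i) := by
  induction h with
  | init => exact ⟨_, splitSet_zero ▸ IsSplitRep.of_trapezoidRep R⟩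
  | step i _ _ π u _ _ hH hu hδ ih =>
    have := hH.finite
    obtain ⟨S, hS⟩ := ih
    rw [splitSet_succ, ← hu]
    exact hS.split (hu ▸ notMem_splitSet hx i)
      (fun w => hH.eq_of_origin_eq (hu ▸ notMem_splitSet hx i)) hδ

end Reaches

theorem ncard_fiber_derivativeOf (p : Set.range x) :
    (derivativeOf x π ⁻¹' {p}).ncard = (π ⁻¹' {(p : V)}).ncard := by
  have hpre : derivativeOf x π ⁻¹' {p} = Subtype.val ⁻¹' (π ⁻¹' {(p : V)}) :=
    Set.ext fun _ => Subtype.ext_iff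
  rw [hpre, Set.ncard_preimage_of_injective_subset_range Subtype.val_injective]
  exact fun w hw => ⟨⟨w, (congrArg (· ∈ Set.range x) hw).mpr p.2⟩, rfl⟩

end Runs

end SplitU

theorem theorem2p1_general {V : Type u} [Finite V] (G : SimpleGraph V) (hG : IsTrapezoidGraph G)
    {k : ℕ} (x : Fin k → V) (hx : Function.Injective x) :
    (∀ (i : Fin k) (W : Type u) (H : SimpleGraph W) (π : W → V),
      SplitU.Reaches G x i W H π → (SplitU.components G (x i)).Nonempty →
        ∃ w : W, π w = x i ∧ ∃ δ δs : Set W, SplitU.IsDelta H w δ δs) ∧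
    (∀ (W : Type u) (H : SimpleGraph W) (π : W → V),
      SplitU.Reaches G x k W H π →
        IsPermutationGraph (SplitU.finalGraph x H π) ∧
        Nat.card (SplitU.FinalVert x π) = 2 * k ∧
        (IsAcyclicTrapezoidGraph G →
          IsAcyclicPermutationGraph (SplitU.finalGraph x H π) (SplitU.derivativeOf x π))) := by
  refine ⟨fun i W H π h => h.exists_isDelta, fun W H π h => ?_⟩
  have := h.finite
  have hfiber : ∀ p, (SplitU.derivativeOf x π ⁻¹' {p}).ncard = 2 := fun p => by
    rw [SplitU.ncard_fiber_derivativeOf]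
    exact h.ncard_fiber hx p (SplitU.splitSet_last.superset p.2)
  have hrep : ∀ R : TrapezoidRep V, R.graph = G →
      ∃ S, SplitU.IsSplitRep R.toTrapezoid H π S (Set.range x) := by
    rintro R rfl
    rw [← SplitU.splitSet_last]
    exact h.exists_isSplitRep hx
  refine ⟨?_, ?_, ?_⟩
  · obtain ⟨R, hR⟩ := hG
    obtain ⟨S, hS⟩ := hrep R hR
    exact ⟨hS.permRep, hS.graph_permRep⟩
  · rw [card_eq_mul_of_ncard_fiber hfiber, Nat.card_range_of_injective hx, Nat.card_fin]
  · rintro ⟨R, rfl, hacyclic⟩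
    obtain ⟨S, hS⟩ := hrep R rfl
    exact ⟨hfiber, hS.permRep, hS.graph_permRep, hS.isAcyclic_permRep (fun _ _ => h.adj) hacyclic⟩

theorem theorem2p1 {V : Type u} [Finite V] (G : SimpleGraph V) (hG : IsTrapezoidGraph G)
    {k : ℕ} (x : Fin k → V) (hx : Function.Injective x)
    (hδ : ∀ i, ∃ δ δs : Set V, SplitU.IsDelta G (x i) δ δs ∧ δs ≠ ∅) :
    -- the algorithm never gets stuck: every step can be carried out
    (∀ (i : Fin k) (W : Type u) (H : SimpleGraph W) (π : W → V),
      SplitU.Reaches G x i W H π →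
        ∃ w : W, π w = x i ∧ ∃ δ δs : Set W, SplitU.IsDelta H w δ δs) ∧
    -- whatever choices are made, the returned graph is as claimed
    (∀ (W : Type u) (H : SimpleGraph W) (π : W → V),
      SplitU.Reaches G x k W H π →
        IsPermutationGraph (SplitU.finalGraph x H π) ∧
        Nat.card (SplitU.FinalVert x π) = 2 * k ∧
        (IsAcyclicTrapezoidGraph G →
          IsAcyclicPermutationGraph (SplitU.finalGraph x H π) (SplitU.derivativeOf x π))) := by
  choose δ _ hδ _ using hδ
  exact (theorem2p1_general G hG x hx).imp_left fun hrun i W H π h =>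
    hrun i W H π h ⟨δ i, (hδ i).1.1⟩
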